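/- **Setting.** Write $R_Z(\varphi)=\mathrm{diag}(1,e^{i\varphi})$, $|\pm\rangle_\delta=R_Z(\delta)|\pm\rangle$ (outcome $0$ stands for $+$, outcome $1$ for $-$), and $H$ for the Hadamard gate. The $n\times m$ brickwork graph, $m=4w+1$, has vertices $(i,j)$, $1\le i\le n$, $1\le j\le m$; $(i,j)$ is joined to $(i,j+1)$, and $(i,j)$ is joined to $(i+1,j)$ exactly when $j\in\{4y-1,\,4y+1\}$ for some $y\in\{1,\dots,w\}$ with $i+y$ even. The brickwork state is obtained from $|+\rangle^{\otimes nm}$ by a controlled-$Z$ gate on every edge; let $E$ be the product of these gates. *Measurement-based computation with angles $\phi=(\phi_{i,j})$.* The qubits of the brickwork state are measured column by column from the left, each column from top to bottom, qubit $(i,j)$ in the basis $|\pm\rangle_{\phi'_{i,j}}$ with the recomputed angle $\phi'_{i,j}=(-1)^{s_X}\phi_{i,j}+s_Z\pi$, where $s_X=s_{i,j-1}$ and $s_Z$ is the sum modulo $2$ of the outcomes $s_{i',j'}$ of all qubits $(i',j')\ne(i,j)$ for which $(i',j'+1)$ is a neighbour of $(i,j)$ (a sum over no qubits is $0$). *Logical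 circuit of $\phi$.* $n$ qubits start in $|+\rangle^{\otimes n}$. For $j=1,\dots,m$ one applies a controlled-$Z$ gate to rows $i,i+1$ for every vertical edge in column $j$, then $R_Z(\phi_{i,j})^\dagger$ on every row $i$, and, if $j<m$, $H$ on every row. Finally all qubits are measured in the Pauli-$X$ basis. Let $L_\phi$ be the law of the $n$ outcomes. *Encrypted run with angles $\phi$ and pad $(\theta,r,r')$*, $\theta_{i,j}\in\{0,\pi/4,\dots,7\pi/4\}$, $r_{i,j},r'_{i,j}\in\{0,1\}$. Alice sends the qubits $R_Z\big(\theta_{i,j}+\pi\sum_{(i',j')\sim(i,j)}r'_{i',j'}\big)|+\rangle$; Bob applies $E$. In the order above, Alice reveals $\delta_{i,j}=(-1)^{r'_{i,j}}\phi'_{i,j}+\theta_{i,j}+r_{i,j}\pi$, Bob measures $(i,j)$ in the basis $|\pm\rangle_{\delta_{i,j}}$ and reports the outcome $b$, and Alice records $s_{i,j}=b\oplus r_{i,j}$; the angles $\phi'$ are computed as above from the recorded outcomes. *Protocol 1 with $v$ traps.* Alice draws $v_t\in\{1,\dots,v+1\}$ uniformly, puts $\phi^{(v_t)}=\phi$ (the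 target), chooses the angles $\phi^{(k)}$ of the trap computations $k\ne v_t$ by some random procedure that is independent of $v_t$, draws independent uniform pads, and for $k=1,\dots,v+1$ carries out the encrypted run with angles $\phi^{(k)}$. She accepts if all recorded last-column outcomes of all traps are $0$ and rejects otherwise. The output is $(s^{(v_t)}_{i,m})_{i=1}^n$. **Theorem (Correctness of Protocol 1).** Let $n,w,v\ge0$, let $\phi$ be the target angles (real, in particular multiples of $\pi/4$), and let the trap angles be drawn from an arbitrary discrete law. Suppose that Bob is honest. 1. For all angles $\alpha$ and every fixed pad $(\theta,r,r')$, the joint law of all recorded outcomes of the encrypted run with angles $\alpha$ is that of all outcomes of the unencrypted measurement-based computation with angles $\alpha$ on the brickwork state. 2. For all angles $\alpha$, the law of the last-column outcomes of the measurement-based computation with angles $\alpha$ is the output law $L_\alpha$ of the logical circuit of $\alpha$. 3. The joint law of Alice's verdict (accept or reject) and of the output of Protocol 1 is the one obtained when, given $v_t$ and the angles $\phi^{(k)}$, the last-column outcomes of the $v+1$ computations are replaced by independent samples from the laws $L_{\phi^{(k)}}$. 4. The output of Protocol 1 has the law $L_\phi$ of the intended computation. Equivalently, the states $\rho_{\mathrm{out}}$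 and $\rho_{\mathrm{ideal}}$ of the output register after Protocol 1 and after the intended computation satisfy $D(\rho_{\mathrm{ideal}},\rho_{\mathrm{out}})=\tfrac12\operatorname{Tr}|\rho_{\mathrm{ideal}}-\rho_{\mathrm{out}}|=0$. -/

import Mathlib

open scoped Matrix MatrixOrder

set_option linter.unusedSectionVars false

noncomputable section

namespace BlindMBQC

/-! ### Qubits and registers

Bits are elements of `ZMod 2`, so that `+` on bits is the exclusive or. A pure state of a register
of qubits labelled by `V` is its family of amplitudes in the computational basis `V → ZMod 2`. -/

section Registers

variable {V : Type} [Fintype V] [DecidableEq V]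

/-- The squared norm of a (not necessarily normalised) state. -/
def normSq {B : Type} [Fintype B] (ψ : B → ℂ) : ℝ := ∑ x, ‖ψ x‖ ^ 2

/-- The gate `R_Z(φ) = diag(1, e^{iφ})`. -/
def RZ (φ : ℝ) : Matrix (ZMod 2) (ZMod 2) ℂ :=
  Matrix.diagonal fun x => if x = 0 then 1 else Complex.exp (Complex.I * φ)

/-- The Hadamard gate. -/
def hadamard : Matrix (ZMod 2) (ZMod 2) ℂ :=
  Matrix.of fun x y => (-1) ^ (x.val * y.val) / (Real.sqrt 2 : ℂ)

/-- The Pauli-`X` eigenvectors: `ketX 0 = |+⟩`, `ketX 1 = |-⟩`. -/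
def ketX (b : ZMod 2) : ZMod 2 → ℂ := fun x => (-1) ^ (b.val * x.val) / (Real.sqrt 2 : ℂ)

/-- The rotated basis `|±⟩_δ = R_Z(δ)|±⟩`, outcome `0` standing for `+`. -/
def ketRot (δ : ℝ) (b : ZMod 2) : ZMod 2 → ℂ := RZ δ *ᵥ ketX b

/-- The tensor product of single-qubit operators, one for each qubit. -/
def tensorOp (M : V → Matrix (ZMod 2) (ZMod 2) ℂ) : Matrix (V → ZMod 2) (V → ZMod 2) ℂ :=
  Matrix.of fun x y => ∏ a, M a (x a) (y a)

/-- The tensor product of single-qubit states. -/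
def productState (f : V → ZMod 2 → ℂ) : (V → ZMod 2) → ℂ := fun x => ∏ a, f a (x a)

/-- The projector `|±⟩_δ⟨±|` on qubit `a`, tensored with the identity on all other qubits. -/
def measProj (a : V) (δ : ℝ) (b : ZMod 2) : Matrix (V → ZMod 2) (V → ZMod 2) ℂ :=
  tensorOp fun c => if c = a then Matrix.vecMulVec (ketRot δ b) (star (ketRot δ b)) else 1

open Classical in
/-- The entangling operation of a graph state: a controlled-`Z` gate for every edge. -/
def entangle (G : SimpleGraph V) : Matrix (V → ZMod 2) (V → ZMod 2) ℂ :=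
  Matrix.diagonal fun x => ∏ e ∈ G.edgeFinset, if ∀ a ∈ e, x a = 1 then -1 else 1

theorem normSq_eq {B : Type} [Fintype B] (ψ : B → ℂ) : (normSq ψ : ℂ) = star ψ ⬝ᵥ ψ := by
  simp only [normSq, dotProduct, Pi.star_apply, RCLike.star_def, Complex.conj_mul']
  push_cast
  rfl

theorem normSq_nonneg {B : Type} [Fintype B] (ψ : B → ℂ) : 0 ≤ normSq ψ :=
  Finset.sum_nonneg fun _ _ => sq_nonneg _

theorem sum_normSq_mulVec {B ι : Type} [Fintype B] [DecidableEq B] [Fintype ι]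
    (K : ι → Matrix B B ℂ) (hK : ∑ b, (K b)ᴴ * K b = 1) (ψ : B → ℂ) :
    ∑ b, normSq (K b *ᵥ ψ) = normSq ψ := by
  have h : ((∑ b, normSq (K b *ᵥ ψ) : ℝ) : ℂ) = (normSq ψ : ℂ) := by
    push_cast
    simp only [normSq_eq, Matrix.star_mulVec, ← Matrix.dotProduct_mulVec, Matrix.mulVec_mulVec]
    rw [← dotProduct_sum, ← Matrix.sum_mulVec, hK, Matrix.one_mulVec]
  exact_mod_cast h

theorem normSq_mulVec {B : Type} [Fintype B] [DecidableEq B]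
    (U : Matrix B B ℂ) (hU : Uᴴ * U = 1) (ψ : B → ℂ) : normSq (U *ᵥ ψ) = normSq ψ := by
  simpa using sum_normSq_mulVec (ι := Unit) (fun _ => U) (by simpa using hU) ψ

theorem tensorOp_mul (M N : V → Matrix (ZMod 2) (ZMod 2) ℂ) :
    tensorOp M * tensorOp N = tensorOp fun a => M a * N a := by
  ext x z
  simp only [tensorOp, Matrix.mul_apply, Matrix.of_apply, ← Finset.prod_mul_distrib]
  rw [Fintype.prod_sum]

theorem tensorOp_one : tensorOp (fun _ : V => (1 : Matrix (ZMod 2) (ZMod 2) ℂ)) = 1 := by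
  ext x y
  simp only [tensorOp, Matrix.of_apply, Matrix.one_apply]
  by_cases h : x = y
  · simp [h]
  · obtain ⟨a, ha⟩ := Function.ne_iff.mp h
    rw [if_neg h]
    exact Finset.prod_eq_zero (Finset.mem_univ a) (by simp [ha])

theorem tensorOp_conjTranspose (M : V → Matrix (ZMod 2) (ZMod 2) ℂ) :
    (tensorOp M)ᴴ = tensorOp fun a => (M a)ᴴ := by
  ext x y
  simp [tensorOp, Matrix.conjTranspose_apply]

theorem sum_tensorOp_single (a : V) (A : ZMod 2 → Matrix (ZMod 2) (ZMod 2) ℂ) :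
    ∑ b, tensorOp (fun c => if c = a then A b else 1)
      = tensorOp fun c => if c = a then ∑ b, A b else 1 := by
  ext x y
  simp only [tensorOp, Matrix.sum_apply, Matrix.of_apply]
  have h : ∀ B : Matrix (ZMod 2) (ZMod 2) ℂ,
      ∏ c, (if c = a then B else 1) (x c) (y c)
        = B (x a) (y a) * ∏ c ∈ Finset.univ.erase a,
            (1 : Matrix (ZMod 2) (ZMod 2) ℂ) (x c) (y c) := by
    intro B
    rw [← Finset.mul_prod_erase _ _ (Finset.mem_univ a), if_pos rfl]
    congr 1
    exact Finset.prod_congr rfl fun c hc => by rw [if_neg (Finset.ne_of_mem_erase hc)]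
  simp only [h, Matrix.sum_apply, Finset.sum_mul]

theorem RZ_unitary (δ : ℝ) : (RZ δ)ᴴ * RZ δ = 1 := by
  rw [RZ, Matrix.diagonal_conjTranspose, Matrix.diagonal_mul_diagonal, ← Matrix.diagonal_one]
  congr 1
  funext x
  simp only [Pi.star_apply, RCLike.star_def]
  split_ifs
  · simp
  · rw [← Complex.exp_conj, ← Complex.exp_add]
    simp

theorem sqrt_two_mul : (Real.sqrt 2 : ℂ) * (Real.sqrt 2 : ℂ) = 2 := by
  rw [← Complex.ofReal_mul, Real.mul_self_sqrt (by norm_num)]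
  norm_num

theorem sum_zmod_two {R : Type} [AddCommMonoid R] (f : ZMod 2 → R) : ∑ b, f b = f 0 + f 1 :=
  Fin.sum_univ_two f

theorem forall_zmod_two {p : ZMod 2 → Prop} : (∀ b, p b) ↔ p 0 ∧ p 1 :=
  Fin.forall_fin_two

theorem val_one_two : (1 : ZMod 2).val = 1 := rfl

theorem hadamard_conjTranspose : hadamardᴴ = hadamard := by
  ext x y
  simp [hadamard, Matrix.conjTranspose_apply, mul_comm]

theorem hadamard_mul_self : hadamard * hadamard = 1 := by
  ext x y
  have h := sqrt_two_mul
  have h0 : (Real.sqrt 2 : ℂ) ≠ 0 := by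
    intro h0
    rw [h0] at h
    norm_num at h
  revert x y
  simp only [forall_zmod_two, hadamard, Matrix.mul_apply, Matrix.of_apply, sum_zmod_two,
    ZMod.val_zero, val_one_two, Matrix.one_apply]
  norm_num
  field_simp
  rw [sq, h]
  norm_num

theorem sum_proj_ketX :
    ∑ b, Matrix.vecMulVec (ketX b) (star (ketX b)) = (1 : Matrix (ZMod 2) (ZMod 2) ℂ) := by
  rw [← hadamard_mul_self]
  ext x y
  simp [hadamard, ketX, Matrix.sum_apply, Matrix.mul_apply, Matrix.vecMulVec_apply, mul_comm]

theorem normSq_ketX (b : ZMod 2) : star (ketX b) ⬝ᵥ ketX b = 1 := by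
  have h := congrFun (congrFun hadamard_mul_self b) b
  rw [Matrix.one_apply_eq] at h
  rw [← h]
  simp [hadamard, ketX, dotProduct, Matrix.mul_apply, mul_comm]

theorem normSq_RZ_ketX (δ : ℝ) (b : ZMod 2) :
    star (RZ δ *ᵥ ketX b) ⬝ᵥ (RZ δ *ᵥ ketX b) = 1 := by
  rw [Matrix.star_mulVec, ← Matrix.dotProduct_mulVec, Matrix.mulVec_mulVec, RZ_unitary,
    Matrix.one_mulVec, normSq_ketX]

theorem sum_proj_ketRot (δ : ℝ) :
    ∑ b, (Matrix.vecMulVec (ketRot δ b) (star (ketRot δ b)))ᴴ *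
      Matrix.vecMulVec (ketRot δ b) (star (ketRot δ b)) = 1 := by
  have h : ∀ b, (Matrix.vecMulVec (ketRot δ b) (star (ketRot δ b)))ᴴ *
      Matrix.vecMulVec (ketRot δ b) (star (ketRot δ b))
        = RZ δ * Matrix.vecMulVec (ketX b) (star (ketX b)) * (RZ δ)ᴴ := by
    intro b
    rw [Matrix.conjTranspose_vecMulVec, star_star, Matrix.vecMulVec_mul_vecMulVec]
    rw [ketRot, normSq_RZ_ketX, one_smul, Matrix.mul_vecMulVec,
      Matrix.vecMulVec_mul, Matrix.star_mulVec]
  simp only [h]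
  rw [← Finset.sum_mul, ← Finset.mul_sum, sum_proj_ketX, mul_one]
  exact mul_eq_one_comm.mp (RZ_unitary δ)

theorem sum_measProj (a : V) (δ : ℝ) :
    ∑ b, (measProj a δ b)ᴴ * measProj a δ b = 1 := by
  have h : ∀ b, (measProj a δ b)ᴴ * measProj a δ b
      = tensorOp fun c => if c = a then (Matrix.vecMulVec (ketRot δ b) (star (ketRot δ b)))ᴴ *
          Matrix.vecMulVec (ketRot δ b) (star (ketRot δ b)) else 1 := by
    intro b
    rw [measProj, tensorOp_conjTranspose, tensorOp_mul]
    congr 1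
    funext c
    split_ifs <;> simp
  simp only [h]
  rw [sum_tensorOp_single, sum_proj_ketRot]
  simp [tensorOp_one]

theorem normSq_productState (f : V → ZMod 2 → ℂ) :
    normSq (productState f) = ∏ a, normSq (f a) := by
  simp only [normSq, productState, norm_prod, ← Finset.prod_pow]
  rw [Fintype.prod_sum]

theorem entangle_unitary (G : SimpleGraph V) : (entangle G)ᴴ * entangle G = 1 := by
  rw [entangle, Matrix.diagonal_conjTranspose, Matrix.diagonal_mul_diagonal,
    ← Matrix.diagonal_one]
  congr 1
  funext x
  rw [Pi.star_apply, star_prod, ← Finset.prod_mul_distrib]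
  refine Finset.prod_eq_one fun e _ => ?_
  split_ifs <;> simp

/-- The weight with which an adaptive sequence of single-qubit measurements leads to a given final
record. The qubits in the list are measured one after the other. Before the measurement of `a`
the angle `δ s a` is computed from the record `s` of the outcomes kept so far; the state is then
projected according to the outcome `b` (without renormalisation, so that the squared norm of the
final state is the probability of the whole history), and `b ⊕ r a` is written in the record. -/
def runWeight (δ : (V → ZMod 2) → V → ℝ) (r : V → ZMod 2) :
    List V → ((V → ZMod 2) → ℂ) → (V → ZMod 2) → (V → ZMod 2) → ℝ
  | [], ψ, s, out => if out = s then normSq ψ else 0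
  | a :: l, ψ, s, out =>
      ∑ b, runWeight δ r l (measProj a (δ s a) b *ᵥ ψ) (Function.update s a (b + r a)) out

theorem runWeight_nonneg (δ : (V → ZMod 2) → V → ℝ) (r : V → ZMod 2) (l : List V)
    (ψ : (V → ZMod 2) → ℂ) (s out : V → ZMod 2) : 0 ≤ runWeight δ r l ψ s out := by
  induction l generalizing ψ s with
  | nil => simp only [runWeight]; split_ifs <;> simp [normSq_nonneg]
  | cons a l ih => exact Finset.sum_nonneg fun b _ => ih _ _

theorem sum_runWeight (δ : (V → ZMod 2) → V → ℝ) (r : V → ZMod 2) (l : List V)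
    (ψ : (V → ZMod 2) → ℂ) (s : V → ZMod 2) : ∑ out, runWeight δ r l ψ s out = normSq ψ := by
  induction l generalizing ψ s with
  | nil => simp [runWeight]
  | cons a l ih =>
    simp only [runWeight]
    rw [Finset.sum_comm]
    simp only [ih]
    exact sum_normSq_mulVec _ (sum_measProj a (δ s a)) ψ

theorem normSq_RZ_plus (θ : ℝ) : normSq (RZ θ *ᵥ ketX 0) = 1 := by
  have h : (normSq (RZ θ *ᵥ ketX 0) : ℂ) = 1 := by rw [normSq_eq, normSq_RZ_ketX]
  exact_mod_cast h

/-- One adaptive measurement-based run on the graph state of `G`: qubit `a` is prepared in the state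
`R_Z(prep a)|+⟩`, the qubits are entangled along the edges of `G`, and they are measured in the
order of the list `l` with the adaptive angles `δ`, outcomes being recorded after the shift
`s ↦ s ⊕ r`. The result is the law of the final record (`0` where nothing is measured). -/
def graphRun (G : SimpleGraph V) (prep : V → ℝ) (δ : (V → ZMod 2) → V → ℝ) (r : V → ZMod 2)
    (l : List V) : PMF (V → ZMod 2) :=
  PMF.ofFintype
    (fun out => ENNReal.ofReal
      (runWeight δ r l (entangle G *ᵥ productState fun a => RZ (prep a) *ᵥ ketX 0) 0 out))
    (by
      rw [← ENNReal.ofReal_sum_of_nonneg fun out _ => runWeight_nonneg _ _ _ _ _ _,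
        sum_runWeight, normSq_mulVec _ (entangle_unitary G), normSq_productState]
      simp [normSq_RZ_plus])

end Registers

/-- Independent sampling: the product law of finitely many laws on a finite type. -/
def independent {ι α : Type} [Fintype ι] [DecidableEq ι] [Fintype α] (p : ι → PMF α) :
    PMF (ι → α) :=
  PMF.ofFintype (fun f => ∏ k, p k (f k)) (by
    rw [← Fintype.prod_sum]
    refine Finset.prod_eq_one fun k _ => ?_
    have h := (p k).tsum_coe
    rwa [tsum_fintype] at h)

/-- The density matrix of a classical register with the given law. -/
def classicalState {α : Type} [Fintype α] [DecidableEq α] (p : PMF α) : Matrix α α ℂ :=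
  Matrix.diagonal fun x => ((p x).toReal : ℂ)

/-- The trace distance `D(ρ, σ) = ½ Tr|ρ - σ|`. -/
def traceDistance {α : Type} [Fintype α] [DecidableEq α] (ρ σ : Matrix α α ℂ) : ℝ :=
  1 / 2 * (CFC.abs (ρ - σ)).trace.re

/-! ### The brickwork state

Rows, columns and tapes are numbered from `0`. A brickwork state with `n` rows and `w` tapes has
`m = 4w + 1` columns, and `(i, j)` is the qubit in row `i` and column `j`. -/

section Brickwork

variable {n w : ℕ}

/-- The physical qubits of a brickwork state with `n` rows and `w` tapes. -/
abbrev Qubit (n w : ℕ) : Type := Fin n × Fin (4 * w + 1)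

/-- The last column. -/
abbrev lastCol (w : ℕ) : Fin (4 * w + 1) := Fin.last (4 * w)

/-- `c` is the right neighbour of `b`, in the same row. -/
def IsNext (b c : Qubit n w) : Prop := b.1 = c.1 ∧ b.2.val + 1 = c.2.val

/-- `b` and `c` are joined by a vertical edge, `c` being in the row below that of `b`: in tape `y`
the bricks have their vertical edges in columns `4y + 2` and `4y + 4` (the third and the fifth
column of the brick), and they join the rows `i` and `i + 1` with `i + y` even. -/
def IsRung (b c : Qubit n w) : Prop :=
  b.2 = c.2 ∧ b.1.val + 1 = c.1.val ∧
    ∃ y : ℕ, (b.2.val = 4 * y + 2 ∨ b.2.val = 4 * y + 4) ∧ Even (b.1.val + y)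

/-- The graph of the brickwork state. -/
def brickwork (n w : ℕ) : SimpleGraph (Qubit n w) :=
  SimpleGraph.fromRel fun b c => IsNext b c ∨ IsRung b c

/-- The order of the measurements: column by column from the left, each column from the top. -/
def measOrder (n w : ℕ) : List (Qubit n w) :=
  (List.finRange (4 * w + 1)).flatMap fun j => (List.finRange n).map fun i => (i, j)

/-! ### Measurement-based computation on the brickwork state -/

open Classical in
/-- The `X`-dependency of qubit `a`: the outcome of its left neighbour. -/
def sX (s : Qubit n w → ZMod 2) (a : Qubit n w) : ZMod 2 :=
  ∑ b with IsNext b a, s b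

open Classical in
/-- The `Z`-dependency of qubit `a`: the sum of the outcomes of the qubits `b ≠ a` whose right
neighbour is a neighbour of `a`. -/
def sZ (s : Qubit n w → ZMod 2) (a : Qubit n w) : ZMod 2 :=
  ∑ b with b ≠ a ∧ ∃ c, IsNext b c ∧ (brickwork n w).Adj c a, s b

/-- The recomputed angle `(-1)^{s_X} φ + s_Z π`. -/
def adapted (φ : Qubit n w → ℝ) (s : Qubit n w → ZMod 2) (a : Qubit n w) : ℝ :=
  (-1) ^ (sX s a).val * φ a + (sZ s a).val * Real.pi

/-- The unencrypted adaptive measurement-based computation on the brickwork state with measurement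
angles `φ`: the law of all its measurement outcomes. -/
def mbqcRun (φ : Qubit n w → ℝ) : PMF (Qubit n w → ZMod 2) :=
  graphRun (brickwork n w) 0 (adapted φ) 0 (measOrder n w)

/-- The outcomes of the measurements of the last column. -/
def lastOutcomes (s : Qubit n w → ZMod 2) : Fin n → ZMod 2 := fun i => s (i, lastCol w)

/-- The operation of column `j` on the `n` logical qubits: the controlled-`Z` gates along the
vertical edges in column `j`, followed by `H R_Z(φ_{i,j})†` on every qubit `i`. -/
def layer (φ : Qubit n w → ℝ) (j : Fin (4 * w + 1)) :
    Matrix (Fin n → ZMod 2) (Fin n → ZMod 2) ℂ :=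
  tensorOp (fun i => hadamard * (RZ (φ (i, j)))ᴴ) *
    entangle ((brickwork n w).comap fun i => (i, j))

/-- The final state of the logical circuit, which starts from `|+⟩^{⊗n}` and applies the operations
of the columns from left to right. The Hadamard gates in the operation of the last column turn the
final measurement in the Pauli-`X` basis into one in the computational basis. -/
def logicalState (φ : Qubit n w → ℝ) : (Fin n → ZMod 2) → ℂ :=
  (List.finRange (4 * w + 1)).foldl (fun ψ j => layer φ j *ᵥ ψ) (productState fun _ => ketX 0)

theorem layer_unitary (φ : Qubit n w → ℝ) (j : Fin (4 * w + 1)) :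
    (layer φ j)ᴴ * layer φ j = 1 := by
  have h : ∀ i, (hadamard * (RZ (φ (i, j)))ᴴ)ᴴ * (hadamard * (RZ (φ (i, j)))ᴴ) = 1 := by
    intro i
    rw [Matrix.conjTranspose_mul, Matrix.conjTranspose_conjTranspose, hadamard_conjTranspose,
      Matrix.mul_assoc, ← Matrix.mul_assoc hadamard, hadamard_mul_self, Matrix.one_mul]
    exact mul_eq_one_comm.mp (RZ_unitary _)
  rw [layer, Matrix.conjTranspose_mul, Matrix.mul_assoc, ← Matrix.mul_assoc (tensorOp _)ᴴ,
    tensorOp_conjTranspose, tensorOp_mul]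
  simp only [h, tensorOp_one, Matrix.one_mul, entangle_unitary]

theorem normSq_logicalState (φ : Qubit n w → ℝ) : normSq (logicalState φ) = 1 := by
  have h : ∀ (l : List (Fin (4 * w + 1))) (ψ : (Fin n → ZMod 2) → ℂ),
      normSq (l.foldl (fun ψ j => layer φ j *ᵥ ψ) ψ) = normSq ψ := by
    intro l
    induction l with
    | nil => simp
    | cons j l ih => intro ψ; rw [List.foldl_cons, ih, normSq_mulVec _ (layer_unitary φ j)]
  have h0 : normSq (ketX 0) = 1 := by
    have h1 : (normSq (ketX 0) : ℂ) = 1 := by rw [normSq_eq, normSq_ketX]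
    exact_mod_cast h1
  rw [logicalState, h, normSq_productState]
  simp [h0]

/-- The law of the output of the logical circuit. -/
def logicalLaw (φ : Qubit n w → ℝ) : PMF (Fin n → ZMod 2) :=
  PMF.ofFintype (fun s => ENNReal.ofReal (‖logicalState φ s‖ ^ 2)) (by
    rw [← ENNReal.ofReal_sum_of_nonneg fun _ _ => sq_nonneg _]
    have h := normSq_logicalState φ
    rw [normSq] at h
    rw [h, ENNReal.ofReal_one])

/-! ### The protocol -/

/-- The random variables `θ`, `r`, `r'` that encrypt one computation; `θ a = k` stands for the
angle `kπ/4`. -/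
abbrev Pad (n w : ℕ) : Type :=
  (Qubit n w → Fin 8) × (Qubit n w → ZMod 2) × (Qubit n w → ZMod 2)

/-- The angle `θ a`. -/
def Pad.θ (p : Pad n w) (a : Qubit n w) : ℝ := (p.1 a).val * (Real.pi / 4)

/-- The bit `r a`. -/
def Pad.r (p : Pad n w) (a : Qubit n w) : ZMod 2 := p.2.1 a

/-- The bit `r' a`. -/
def Pad.r' (p : Pad n w) (a : Qubit n w) : ZMod 2 := p.2.2 a

open Classical in
/-- The angle `θ_a + π ∑_{b ∼ a} r'_b` by which Alice rotates the qubit `a` that she sends. -/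
def prepAngle (p : Pad n w) (a : Qubit n w) : ℝ :=
  Pad.θ p a + Real.pi * ∑ b with (brickwork n w).Adj a b, ((Pad.r' p b).val : ℝ)

/-- The angle `δ_a = (-1)^{r'_a} φ_a + θ_a + r_a π` that Alice reveals to Bob, `φ_a` being the angle
recomputed from the record of the (recomputed) outcomes of the qubits measured before. -/
def blindAngle (φ : Qubit n w → ℝ) (p : Pad n w) (s : Qubit n w → ZMod 2) (a : Qubit n w) : ℝ :=
  (-1) ^ (Pad.r' p a).val * adapted φ s a + Pad.θ p a + (Pad.r p a).val * Real.pi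

/-- One encrypted computation with angles `φ` and with honest Bob: the law of the outcomes
`s ⊕ r` recomputed by Alice. -/
def blindRun (φ : Qubit n w → ℝ) (p : Pad n w) : PMF (Qubit n w → ZMod 2) :=
  graphRun (brickwork n w) (prepAngle p) (blindAngle φ p) (Pad.r p) (measOrder n w)

/-- The protocol with honest Bob, `v` traps and target angles `φ`. Alice draws the position `vt` of
the target computation; the angles of the other computations are drawn from the law `traps` (the
entry `vt` of the draw is replaced by the target); she draws all the pads and the computations are
run. The result is Alice's verdict (`true` if she accepts, that is if the last-column outcomes of
all traps are `0`), together with the last-column outcomes of the target computation. -/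
def protocol (v : ℕ) (φ : Qubit n w → ℝ) (traps : PMF (Fin (v + 1) → Qubit n w → ℝ)) :
    PMF (Bool × (Fin n → ZMod 2)) :=
  (PMF.uniformOfFintype (Fin (v + 1))).bind fun vt =>
  traps.bind fun τ =>
  (PMF.uniformOfFintype (Fin (v + 1) → Pad n w)).bind fun p =>
  (independent fun k => blindRun (Function.update τ vt φ k) (p k)).bind fun s =>
  PMF.pure (decide (∀ k, k ≠ vt → lastOutcomes (s k) = 0), lastOutcomes (s vt))

/-- The ideal counterpart of the protocol, without encryption and without measurement-based
computation: the last-column outcomes of the `v + 1` computations are the independent outputs of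
the logical circuits. -/
def idealProtocol (v : ℕ) (φ : Qubit n w → ℝ) (traps : PMF (Fin (v + 1) → Qubit n w → ℝ)) :
    PMF (Bool × (Fin n → ZMod 2)) :=
  (PMF.uniformOfFintype (Fin (v + 1))).bind fun vt =>
  traps.bind fun τ =>
  (independent fun k => logicalLaw (Function.update τ vt φ k)).bind fun s =>
  PMF.pure (decide (∀ k, k ≠ vt → s k = 0), s vt)

end Brickwork

end BlindMBQC

end

noncomputable section

namespace BlindMBQC

/-! ### The probability of a measurement record -/

section Runs

variable {V : Type} [Fintype V] [DecidableEq V]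

/-! Each measurement angle depends only on outcomes in earlier columns. For a fixed final record the
adaptive projectors therefore form one tensor product of rank-one projectors, with angles read off
that record. By Born's rule the probability of the record is a constant times `‖amplitude‖ ^ 2`,
where `amplitude` is a sum over bit strings `x` of local phases times `(-1)` to the quadratic form
`edgeForm`.

The key symmetry is `norm_amplitude_reflect`: translating `x` by `t` reflects the angles where `t =
1` and flips the signs at each qubit by the sum of `t` over its neighbours, without changing the
modulus. These are the stabilisers of the graph state. With `t = r'` it removes the pad
(`blindRun_eq_mbqcRun`). With `t = sX s` it removes the adaptive corrections, so a record's
probability depends on its last column only (`norm_amplitude_adapted`).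

The path sum of the logical circuit is the same amplitude up to a nonzero constant
(`logicalState_eq`), so the two output laws are proportional, hence equal. The claims on the
protocol follow by pushing independent products forward and taking a marginal. -/

theorem runWeight_eq_normSq (δ : (V → ZMod 2) → V → ℝ) (r : V → ZMod 2) (rank : V → ℕ)
    (hδ : ∀ s s' a, (∀ b, rank b < rank a → s b = s' b) → δ s a = δ s' a)
    (out : V → ZMod 2) (l : List V) (hl : l.Nodup) (hr : l.Pairwise fun a b => rank a ≤ rank b)
    (ψ : (V → ZMod 2) → ℂ) (s : V → ZMod 2) :
    runWeight δ r l ψ s out = if ∀ a, a ∉ l → out a = s a then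
      normSq (tensorOp (fun c => if c ∈ l then
        Matrix.vecMulVec (ketRot (δ out c) (out c + r c)) (star (ketRot (δ out c) (out c + r c)))
        else 1) *ᵥ ψ) else 0 := by
  induction l generalizing ψ s with
  | nil =>
    simp only [runWeight, List.not_mem_nil, not_false_eq_true, forall_const, if_false, tensorOp_one,
      Matrix.one_mulVec, funext_iff]
  | cons a l ih =>
    rw [List.nodup_cons] at hl
    rw [List.pairwise_cons] at hr
    simp only [runWeight, ih hl.2 hr.2]
    -- Since `a` is not measured again, its recorded bit `b + r a` is final. Only this outcome can
    -- lead to `out`.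
    rw [Finset.sum_eq_single (out a + r a)]
    · have e : out a + r a + r a = out a := by rw [add_assoc, CharTwo.add_self_eq_zero, add_zero]
      rw [e]
      have hc : (∀ c, c ∉ l → out c = Function.update s a (out a) c) ↔
          ∀ c, c ∉ a :: l → out c = s c := by
        refine forall_congr' fun c => ?_
        by_cases h : c = a
        · subst h; simp
        · simp [h]
      simp only [hc]
      refine if_ctx_congr Iff.rfl (fun h => ?_) fun _ => rfl
      -- The list is sorted by rank, so qubits of rank below that of `a` lie outside `a :: l`, where
      -- `s` already agrees with `out`.
      have hs : δ s a = δ out a := by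
        refine hδ _ _ _ fun b hb => (h b ?_).symm
        rw [List.mem_cons, not_or]
        refine ⟨fun h => by simp [h] at hb, fun h => ?_⟩
        exact absurd (hr.1 b h) (not_le.mpr hb)
      rw [hs, measProj, Matrix.mulVec_mulVec, tensorOp_mul]
      congr 3
      funext c
      by_cases h : c = a
      · subst h; simp [hl.1]
      · simp [h]
    · intro b _ hb
      rw [if_neg]
      intro h
      have := h a hl.1
      rw [Function.update_self] at this
      exact hb (by rw [this, add_assoc, CharTwo.add_self_eq_zero, add_zero])
    · simp

theorem normSq_ketRot (δ : ℝ) (b : ZMod 2) : normSq (ketRot δ b) = 1 := by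
  have h : (normSq (ketRot δ b) : ℂ) = 1 := by rw [normSq_eq, ketRot, normSq_RZ_ketX]
  exact_mod_cast h

theorem normSq_smul {B : Type} [Fintype B] (c : ℂ) (ψ : B → ℂ) :
    normSq (c • ψ) = ‖c‖ ^ 2 * normSq ψ := by
  simp [normSq, mul_pow, Finset.mul_sum]

theorem tensorOp_vecMulVec (f g : V → ZMod 2 → ℂ) :
    tensorOp (fun a => Matrix.vecMulVec (f a) (g a)) =
      Matrix.vecMulVec (productState f) (productState g) := by
  ext x y
  simp [tensorOp, Matrix.vecMulVec_apply, productState, Finset.prod_mul_distrib]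

/-- The weight of a record of an adaptive measurement of all qubits, given by Born's rule. -/
theorem runWeight_eq_inner (δ : (V → ZMod 2) → V → ℝ) (r : V → ZMod 2) (rank : V → ℕ)
    (hδ : ∀ s s' a, (∀ b, rank b < rank a → s b = s' b) → δ s a = δ s' a)
    (out : V → ZMod 2) (l : List V) (hl : l.Nodup) (hr : l.Pairwise fun a b => rank a ≤ rank b)
    (hm : ∀ a, a ∈ l) (ψ : (V → ZMod 2) → ℂ) (s : V → ZMod 2) :
    runWeight δ r l ψ s out =
      ‖productState (fun c => star (ketRot (δ out c) (out c + r c))) ⬝ᵥ ψ‖ ^ 2 := by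
  rw [runWeight_eq_normSq δ r rank hδ out l hl hr, if_pos fun a h => absurd (hm a) h]
  simp only [hm, if_true]
  rw [tensorOp_vecMulVec, Matrix.vecMulVec_mulVec, op_smul_eq_smul, normSq_smul,
    normSq_productState]
  simp [normSq_ketRot]

end Runs

/-! ### Signs and graph states -/

/-- The sign `(-1)^c`. -/
def sign (c : ZMod 2) : ℂ := (-1) ^ c.val

theorem sign_zero : sign 0 = 1 := by simp [sign]

theorem sign_one : sign 1 = -1 := by simp [sign, val_one_two]

theorem sign_add (b c : ZMod 2) : sign (b + c) = sign b * sign c := by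
  revert b c
  simp only [forall_zmod_two, sign_zero, sign_one, add_zero, zero_add, CharTwo.add_self_eq_zero]
  norm_num

theorem sign_sum {ι : Type} (s : Finset ι) (f : ι → ZMod 2) :
    sign (∑ i ∈ s, f i) = ∏ i ∈ s, sign (f i) := by
  classical
  induction s using Finset.induction_on with
  | empty => simp [sign_zero]
  | insert a s h ih => rw [Finset.sum_insert h, Finset.prod_insert h, sign_add, ih]

theorem norm_sign (c : ZMod 2) : ‖sign c‖ = 1 := by simp [sign]

theorem star_sign (c : ZMod 2) : star (sign c) = sign c := by simp [sign]

theorem ketX_apply (b x : ZMod 2) : ketX b x = sign (b * x) / (Real.sqrt 2 : ℂ) := by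
  revert b x
  simp [forall_zmod_two, ketX, sign, val_one_two]

theorem hadamard_apply (b x : ZMod 2) : hadamard b x = sign (b * x) / (Real.sqrt 2 : ℂ) :=
  ketX_apply b x

/-- The phase `e^{iβx}` of a bit `x`. -/
def phase (β : ℝ) (x : ZMod 2) : ℂ := if x = 0 then 1 else Complex.exp (Complex.I * β)

theorem phase_zero (β : ℝ) : phase β 0 = 1 := if_pos rfl

theorem phase_one (β : ℝ) : phase β 1 = Complex.exp (Complex.I * β) := if_neg one_ne_zero

theorem phase_add (β γ : ℝ) (x : ZMod 2) : phase (β + γ) x = phase β x * phase γ x := by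
  revert x
  simp [forall_zmod_two, phase_zero, phase_one, mul_add, Complex.exp_add]

theorem star_phase (β : ℝ) (x : ZMod 2) : star (phase β x) = phase (-β) x := by
  revert x
  simp [forall_zmod_two, phase_zero, phase_one, ← Complex.exp_conj]

theorem norm_phase (β : ℝ) (x : ZMod 2) : ‖phase β x‖ = 1 := by
  revert x
  simp [forall_zmod_two, phase_zero, phase_one, Complex.norm_exp]

theorem phase_pi (k : ℕ) (x : ZMod 2) : phase (k * Real.pi) x = sign (k * x) := by
  revert x
  refine forall_zmod_two.mpr ⟨by simp [phase_zero, sign_zero], ?_⟩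
  induction k with
  | zero => simp [phase_one, sign_zero]
  | succ k ih =>
    push_cast
    rw [add_mul, add_mul, phase_add, ih, sign_add, one_mul, one_mul, phase_one, sign_one, mul_comm
      Complex.I, Complex.exp_pi_mul_I]

theorem RZ_mulVec_ketX (β : ℝ) (b x : ZMod 2) :
    (RZ β *ᵥ ketX b) x = phase β x * sign (b * x) / (Real.sqrt 2 : ℂ) := by
  rw [RZ, Matrix.mulVec_diagonal, ketX_apply, phase, mul_div_assoc]

/-- Reflecting an angle amounts to flipping the bit, up to a phase. -/
theorem phase_reflect (β : ℝ) (t x : ZMod 2) :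
    phase ((-1) ^ t.val * β) (x + t) = phase ((-1) ^ t.val * β) t * phase β x := by
  revert t x
  simp only [forall_zmod_two, phase_zero, phase_one, add_zero, zero_add, CharTwo.add_self_eq_zero,
    ZMod.val_zero, val_one_two]
  simp [← Complex.exp_add]

section Graphs

variable {V : Type} [Fintype V] [DecidableEq V]

open Classical in
/-- The number modulo two of edges of an orientation `R` both of whose ends carry the bit `1`. -/
def edgeForm (R : V → V → Prop) (x : V → ZMod 2) : ZMod 2 :=
  ∑ a, ∑ b, if R a b then x a * x b else 0

-- An asymmetric irreflexive `R` contains exactly one ordered pair for each edge, so the product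
-- over edges can be taken over these pairs, each contributing `sign (x a * x b)`.
open Classical in
theorem entangle_fromRel (R : V → V → Prop) (hR : ∀ a b, R a b → a ≠ b ∧ ¬R b a) :
    entangle (SimpleGraph.fromRel R) = Matrix.diagonal fun x => sign (edgeForm R x) := by
  rw [entangle]
  congr 1
  funext x
  have he : (SimpleGraph.fromRel R).edgeFinset =
      (Finset.univ.filter fun p : V × V => R p.1 p.2).image fun p => s(p.1, p.2) := by
    ext e
    induction e with
    | _ a b =>
      simp only [SimpleGraph.mem_edgeFinset, SimpleGraph.mem_edgeSet, SimpleGraph.fromRel_adj,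
        Finset.mem_image, Finset.mem_filter, Finset.mem_univ, true_and, Prod.exists]
      constructor
      · rintro ⟨_, h | h⟩
        · exact ⟨a, b, h, rfl⟩
        · exact ⟨b, a, h, Sym2.eq_swap⟩
      · rintro ⟨c, d, h, hcd⟩
        rcases Sym2.eq_iff.mp hcd with ⟨rfl, rfl⟩ | ⟨rfl, rfl⟩
        · exact ⟨(hR _ _ h).1, Or.inl h⟩
        · exact ⟨(hR _ _ h).1.symm, Or.inr h⟩
  have hinj : Set.InjOn (fun p : V × V => s(p.1, p.2))
      (Finset.univ.filter fun p : V × V => R p.1 p.2) := by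
    rintro ⟨a, b⟩ h ⟨c, d⟩ h' hcd
    simp only [Finset.coe_filter, Finset.mem_univ, true_and, Set.mem_ofPred_eq] at h h'
    rcases Sym2.eq_iff.mp hcd with ⟨rfl, rfl⟩ | ⟨rfl, rfl⟩
    · rfl
    · exact absurd h' (hR _ _ h).2
  have hs : edgeForm R x = ∑ p : V × V with R p.1 p.2, x p.1 * x p.2 := by
    rw [Finset.sum_filter, Fintype.sum_prod_type, edgeForm]
  rw [hs, sign_sum]
  trans ∏ e ∈ (Finset.univ.filter fun p : V × V => R p.1 p.2).image fun p => s(p.1, p.2),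
      if ∀ a ∈ e, x a = 1 then (-1 : ℂ) else 1
  · refine Finset.prod_congr ?_ fun _ _ => ?_
    · rw [← he]
      congr!
    · congr
  rw [Finset.prod_image hinj]
  refine Finset.prod_congr rfl fun p _ => ?_
  have key : ∀ u v : ZMod 2, (if u = 1 ∧ v = 1 then (-1 : ℂ) else 1) = sign (u * v) := by
    simp [forall_zmod_two, sign_zero, sign_one]
  rw [← key]
  simp only [Sym2.mem_iff, forall_eq_or_imp, forall_eq]

-- Polarisation of the quadratic form: the cross terms `x a * t b` and `t a * x b` of an oriented
-- edge together make up the symmetric adjacency form.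
open Classical in
theorem edgeForm_add (R : V → V → Prop) (hR : ∀ a b, R a b → a ≠ b ∧ ¬R b a)
    (x t : V → ZMod 2) :
    edgeForm R (x + t) = edgeForm R x + edgeForm R t +
      ∑ a, x a * ∑ b with (SimpleGraph.fromRel R).Adj a b, t b := by
  have h : ∀ a, x a * ∑ b with (SimpleGraph.fromRel R).Adj a b, t b =
      (∑ b, if R a b then x a * t b else 0) + ∑ b, if R b a then x a * t b else 0 := by
    intro a
    rw [Finset.sum_filter, Finset.mul_sum, ← Finset.sum_add_distrib]
    refine Finset.sum_congr rfl fun b _ => ?_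
    simp only [SimpleGraph.fromRel_adj]
    have h1 := hR a b
    have h2 := hR b a
    by_cases hab : R a b
    · simp [hab, h1 hab]
    · by_cases hba : R b a
      · simp [hba, hab, (h2 hba).1.symm]
      · simp [hab, hba]
  simp only [h]
  rw [Finset.sum_add_distrib, Finset.sum_comm (f := fun a b => if R b a then x a * t b else 0)]
  simp only [edgeForm, ← Finset.sum_add_distrib]
  refine Finset.sum_congr rfl fun a _ => Finset.sum_congr rfl fun b _ => ?_
  split_ifs
  · simp only [Pi.add_apply]; ring
  · simp

/-- The unnormalised amplitude with which the qubits of a graph state are found in the basis states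
`R_Z(β_a)|±⟩`, with signs `c`. -/
def amplitude (R : V → V → Prop) (β : V → ℝ) (c : V → ZMod 2) : ℂ :=
  ∑ x : V → ZMod 2, (∏ a, phase (-β a) (x a) * sign (c a * x a)) * sign (edgeForm R x)

-- Substituting `x + t` for `x` in the sum produces three effects: `phase_reflect` at every qubit,
-- the adjacency cross term of `edgeForm_add`, and factors independent of `x`. The cross term is
-- cancelled by the change of signs, and the remaining factors have modulus one.
open Classical in
theorem norm_amplitude_reflect (R : V → V → Prop) (hR : ∀ a b, R a b → a ≠ b ∧ ¬R b a)
    (β : V → ℝ) (c t : V → ZMod 2) :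
    ‖amplitude R (fun a => (-1) ^ (t a).val * β a)
        (fun a => c a + ∑ b with (SimpleGraph.fromRel R).Adj a b, t b)‖ =
      ‖amplitude R β c‖ := by
  set N : V → ZMod 2 := fun a => ∑ b with (SimpleGraph.fromRel R).Adj a b, t b with hN
  have h : amplitude R (fun a => (-1) ^ (t a).val * β a) (fun a => c a + N a) =
      (∏ a, phase ((-1) ^ (t a).val * -β a) (t a) * sign ((c a + N a) * t a)) *
        sign (edgeForm R t) * amplitude R β c := by
    rw [amplitude, ← Equiv.sum_comp (Equiv.addRight t), amplitude, Finset.mul_sum]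
    refine Finset.sum_congr rfl fun x _ => ?_
    simp only [Equiv.coe_addRight]
    rw [edgeForm_add R hR, sign_add, sign_add, sign_sum]
    have h1 : ∀ a, phase (-((-1) ^ (t a).val * β a)) ((x + t) a) * sign ((c a + N a) * (x + t) a) *
        sign (x a * N a) =
        (phase ((-1) ^ (t a).val * -β a) (t a) * sign ((c a + N a) * t a)) *
          (phase (-β a) (x a) * sign (c a * x a)) := by
      intro a
      have h2 : sign ((c a + N a) * (x a + t a)) * sign (x a * N a) =
          sign ((c a + N a) * t a) * sign (c a * x a) := by
        rw [← sign_add, ← sign_add]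
        congr 1
        -- The product `x a * N a` arises once from the shifted signs and once from the cross term.
        linear_combination (CharTwo.add_self_eq_zero (x a * N a))
      rw [← mul_neg, Pi.add_apply, phase_reflect, mul_assoc, h2]
      ring
    have h3 := Finset.prod_congr (rfl : (Finset.univ : Finset V) = _) fun a _ => h1 a
    rw [Finset.prod_mul_distrib, Finset.prod_mul_distrib (s := Finset.univ)
      (f := fun a => phase ((-1) ^ (t a).val * -β a) (t a) * sign ((c a + N a) * t a))] at h3
    linear_combination (sign (edgeForm R x) * sign (edgeForm R t)) * h3
  rw [h]
  simp [norm_phase, norm_sign]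

/-- The normalised amplitude of a record. -/
theorem inner_graphState (R : V → V → Prop) (hR : ∀ a b, R a b → a ≠ b ∧ ¬R b a)
    (prep δ : V → ℝ) (c : V → ZMod 2) :
    productState (fun a => star (ketRot (δ a) (c a))) ⬝ᵥ
      (entangle (SimpleGraph.fromRel R) *ᵥ productState fun a => RZ (prep a) *ᵥ ketX 0) =
      (∏ _a : V, (1 / 2 : ℂ)) * amplitude R (fun a => δ a - prep a) c := by
  rw [entangle_fromRel R hR, amplitude, dotProduct, Finset.mul_sum]
  refine Finset.sum_congr rfl fun x _ => ?_
  rw [Matrix.mulVec_diagonal, productState, productState, mul_left_comm,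
    ← Finset.prod_mul_distrib, ← mul_assoc, ← Finset.prod_mul_distrib, mul_comm]
  congr 1
  refine Finset.prod_congr rfl fun a _ => ?_
  simp only [Pi.star_apply]
  -- The factor `1 / 2` of each qubit is `1 / √2` from the prepared state times `1 / √2` from the
  -- measured basis vector.
  rw [ketRot, RZ_mulVec_ketX, RZ_mulVec_ketX, star_div₀, star_mul, star_sign, star_phase, zero_mul,
    sign_zero, neg_sub, sub_eq_add_neg, phase_add]
  have h : star (Real.sqrt 2 : ℂ) = Real.sqrt 2 := Complex.conj_ofReal _
  have h' : (Real.sqrt 2 : ℂ) ≠ 0 := by simp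
  rw [h]
  field_simp
  linear_combination (-phase (prep a) (x a) * phase (-δ a) (x a) * sign (c a * x a)) * sqrt_two_mul

/-- Shifting the angles by multiples of `π` amounts to relabelling the outcomes. -/
theorem amplitude_add_pi (R : V → V → Prop) (β : V → ℝ) (k : V → ℤ) (c : V → ZMod 2) :
    amplitude R (fun a => β a + k a * Real.pi) c = amplitude R β fun a => c a + k a := by
  -- Integers are needed because the preparation angle is subtracted; only the parity of `k`
  -- matters.
  have hk : ∀ (k : ℤ) (x : ZMod 2), phase (-(k * Real.pi)) x = sign (k * x) := by
    intro k x
    rcases k.eq_nat_or_neg with ⟨m, rfl | rfl⟩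
    · rw [← star_phase, Int.cast_natCast, Int.cast_natCast, phase_pi, star_sign]
    · push_cast
      rw [neg_mul, neg_neg, phase_pi, CharTwo.neg_eq]
  simp only [amplitude]
  refine Finset.sum_congr rfl fun x _ => ?_
  congr 1
  refine Finset.prod_congr rfl fun a _ => ?_
  rw [neg_add, phase_add, hk, add_mul, sign_add]
  ring

end Graphs

/-! ### Discrete laws -/

section Laws

/-- Two laws that are proportional to each other are equal. -/
theorem PMF_eq_of_proportional {α : Type} [Fintype α] (p q : PMF α) (k : ENNReal)
    (h : ∀ a, p a = k * q a) : p = q := by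
  have hp := p.tsum_coe
  have hq := q.tsum_coe
  rw [tsum_fintype] at hp hq
  simp only [h, ← Finset.mul_sum, hq, mul_one] at hp
  ext a
  rw [h, hp, one_mul]

open Classical in
theorem independent_map {ι α β : Type} [Fintype ι] [DecidableEq ι] [Fintype α] [Fintype β]
    (p : ι → PMF α) (f : α → β) :
    (independent p).map (fun s k => f (s k)) = independent fun k => (p k).map f := by
  ext y
  rw [PMF.map_apply, tsum_fintype]
  simp only [independent, PMF.ofFintype_apply, PMF.map_apply, tsum_fintype]
  rw [Fintype.prod_sum]
  refine Finset.sum_congr rfl fun s _ => ?_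
  by_cases h : ∀ k, y k = f (s k)
  · rw [if_pos (funext h)]
    exact Finset.prod_congr rfl fun k _ => (if_pos (h k)).symm
  · rw [if_neg fun e => h (congrFun e)]
    obtain ⟨k, hk⟩ := not_forall.mp h
    exact (Finset.prod_eq_zero (Finset.mem_univ k) (if_neg hk)).symm

-- The indicator of `y = s i` is absorbed into the `i`-th factor. The sum of products then
-- factorises, and every other factor sums to one.
open Classical in
theorem independent_map_apply {ι α : Type} [Fintype ι] [DecidableEq ι] [Fintype α]
    (p : ι → PMF α) (i : ι) : (independent p).map (fun s => s i) = p i := by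
  ext y
  rw [PMF.map_apply, tsum_fintype]
  simp only [independent, PMF.ofFintype_apply]
  have h : ∀ s : ι → α, (if y = s i then ∏ k, p k (s k) else 0) =
      ∏ k, if k = i → y = s k then p k (s k) else 0 := by
    intro s
    by_cases hs : y = s i
    · rw [if_pos hs]
      exact Finset.prod_congr rfl fun k _ => (if_pos (by rintro rfl; exact hs)).symm
    · rw [if_neg hs]
      exact (Finset.prod_eq_zero (Finset.mem_univ i) (if_neg (by simp [hs]))).symm
  simp only [h]
  rw [← Fintype.prod_sum (f := fun k a => if k = i → y = a then p k a else 0),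
    Finset.prod_eq_single i]
  · simp
  · intro k _ hk
    have hp := (p k).tsum_coe
    rw [tsum_fintype] at hp
    simpa [hk] using hp
  · simp

end Laws

/-! ### Path sums -/

/-- `x j` is the basis state just before operation `j`, and `y` the one after the last. The
induction splits off the last operation. -/
theorem foldl_mulVec_eq_sum {B : Type} [Fintype B] (k : ℕ) (M : Fin (k + 1) → Matrix B B ℂ)
    (ψ : B → ℂ) (y : B) :
    (List.finRange (k + 1)).foldl (fun ψ j => M j *ᵥ ψ) ψ y =
      ∑ x : Fin (k + 1) → B, ψ (x 0) * (∏ j : Fin k, M j.castSucc (x j.succ) (x j.castSucc)) *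
        M (Fin.last k) y (x (Fin.last k)) := by
  induction k generalizing y with
  | zero =>
    rw [← (Equiv.funUnique (Fin 1) B).symm.sum_comp]
    simp [List.finRange_succ, Matrix.mulVec, dotProduct, mul_comm]
  | succ k ih =>
    rw [List.finRange_succ_last, List.foldl_append, List.foldl_map]
    rw [List.foldl_cons, List.foldl_nil, Matrix.mulVec, dotProduct]
    simp only [ih fun j => M j.castSucc]
    rw [← (Fin.snocEquiv fun _ : Fin (k + 2) => B).sum_comp, Fintype.sum_prod_type]
    refine Finset.sum_congr rfl fun b _ => ?_
    rw [Finset.mul_sum]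
    refine Finset.sum_congr rfl fun x _ => ?_
    have h0 : (0 : Fin (k + 2)) = (0 : Fin (k + 1)).castSucc := rfl
    simp only [Fin.snocEquiv, Equiv.coe_fn_mk]
    rw [Fin.prod_univ_castSucc, h0]
    simp only [Fin.succ_last, Fin.succ_castSucc, Fin.snoc_castSucc, Fin.snoc_last]
    ring

/-! ### The brickwork state -/

section Brickwork

variable {n w : ℕ}

/-- The edges of the brickwork graph, directed to the right and downwards. -/
def Arc (b c : Qubit n w) : Prop := IsNext b c ∨ IsRung b c

theorem brickwork_eq : brickwork n w = SimpleGraph.fromRel Arc := rfl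

theorem arc_asymm (b c : Qubit n w) (h : Arc b c) : b ≠ c ∧ ¬Arc c b := by
  obtain ⟨⟨i, hi⟩, j, hj⟩ := b
  obtain ⟨⟨i', hi'⟩, j', hj'⟩ := c
  simp only [Arc, IsNext, IsRung, Fin.mk.injEq, ne_eq, Prod.mk.injEq] at h ⊢
  omega

theorem comap_brickwork (j : Fin (4 * w + 1)) :
    (brickwork n w).comap (fun i => (i, j)) =
      SimpleGraph.fromRel fun i i' : Fin n => IsRung (w := w) (i, j) (i', j) := by
  ext i i'
  simp [brickwork, IsNext]

theorem rung_asymm (j : Fin (4 * w + 1)) (i i' : Fin n)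
    (h : IsRung (w := w) (i, j) (i', j)) : i ≠ i' ∧ ¬IsRung (w := w) (i', j) (i, j) := by
  have := arc_asymm _ _ (Or.inr h)
  exact ⟨fun e => this.1 (by rw [e]), fun e => this.2 (Or.inr e)⟩

theorem col_lt_of_isNext {b c : Qubit n w} (h : IsNext b c) : b.2.val < c.2.val := by
  have := h.2
  omega

theorem isNext_left_unique {b c c' : Qubit n w} (h : IsNext b c) (h' : IsNext b c') : c = c' :=
  Prod.ext (h.1.symm.trans h'.1) (Fin.ext (h.2.symm.trans h'.2))

/-- The only neighbour of `c` to its left is `b`, which is excluded; all others lie in the column of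
`c` or to its right. -/
theorem col_lt_of_dep {a b c : Qubit n w} (hba : b ≠ a) (hbc : IsNext b c)
    (hca : (brickwork n w).Adj c a) : b.2.val < a.2.val := by
  obtain ⟨⟨i, hi⟩, j, hj⟩ := a
  obtain ⟨⟨i', hi'⟩, j', hj'⟩ := b
  obtain ⟨⟨k, hk⟩, l, hl⟩ := c
  simp only [brickwork, SimpleGraph.fromRel_adj, IsNext, IsRung, Fin.mk.injEq, ne_eq,
    Prod.mk.injEq] at hba hbc hca ⊢
  omega

open Classical in
theorem adapted_congr (φ : Qubit n w → ℝ) (s s' : Qubit n w → ZMod 2) (a : Qubit n w)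
    (h : ∀ b : Qubit n w, b.2.val < a.2.val → s b = s' b) : adapted φ s a = adapted φ s' a := by
  have hX : sX s a = sX s' a := by
    rw [sX, sX]
    refine Finset.sum_congr rfl fun b hb => h b ?_
    rw [Finset.mem_filter] at hb
    exact col_lt_of_isNext hb.2
  have hZ : sZ s a = sZ s' a := by
    rw [sZ, sZ]
    refine Finset.sum_congr rfl fun b hb => h b ?_
    rw [Finset.mem_filter] at hb
    obtain ⟨_, hba, c, hbc, hca⟩ := hb
    exact col_lt_of_dep hba hbc hca
  rw [adapted, adapted, hX, hZ]

theorem mem_measOrder (a : Qubit n w) : a ∈ measOrder n w := by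
  simp [measOrder]

theorem pairwise_measOrder :
    (measOrder n w).Pairwise fun a b => a.2.val ≤ b.2.val := by
  rw [measOrder, List.pairwise_flatMap]
  refine ⟨fun j _ => ?_, ?_⟩
  · rw [List.pairwise_map]
    exact List.pairwise_of_forall fun _ _ => le_rfl
  · refine (List.pairwise_lt_finRange _).imp fun {j j'} h => ?_
    simp only [List.mem_map, List.mem_finRange, true_and]
    rintro _ ⟨i, rfl⟩ _ ⟨i', rfl⟩
    exact le_of_lt h

theorem nodup_measOrder : (measOrder n w).Nodup := by
  rw [measOrder, List.nodup_flatMap]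
  refine ⟨fun j _ => (List.nodup_finRange n).map fun _ _ h => (Prod.mk.inj h).1, ?_⟩
  refine (List.nodup_finRange _).imp fun {j j'} h => ?_
  simp only [Function.onFun, List.disjoint_left, List.mem_map, List.mem_finRange, true_and]
  rintro _ ⟨i, rfl⟩ ⟨i', h'⟩
  exact h (Prod.mk.inj h').2.symm

/-- Born's rule for an adaptive run on the brickwork state. -/
theorem graphRun_brickwork (prep : Qubit n w → ℝ) (δ : (Qubit n w → ZMod 2) → Qubit n w → ℝ)
    (r : Qubit n w → ZMod 2)
    (hδ : ∀ s s' a, (∀ b : Qubit n w, b.2.val < a.2.val → s b = s' b) → δ s a = δ s' a)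
    (out : Qubit n w → ZMod 2) :
    graphRun (brickwork n w) prep δ r (measOrder n w) out =
      ENNReal.ofReal (‖∏ _a : Qubit n w, (1 / 2 : ℂ)‖ ^ 2 *
        ‖amplitude Arc (fun a => δ out a - prep a) (fun a => out a + r a)‖ ^ 2) := by
  rw [graphRun, PMF.ofFintype_apply, runWeight_eq_inner δ r (fun a => a.2.val) hδ out _
    nodup_measOrder pairwise_measOrder mem_measOrder, brickwork_eq, inner_graphState _ arc_asymm,
    norm_mul, mul_pow]

theorem mbqcRun_apply (α : Qubit n w → ℝ) (out : Qubit n w → ZMod 2) :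
    mbqcRun α out = ENNReal.ofReal (‖∏ _a : Qubit n w, (1 / 2 : ℂ)‖ ^ 2 *
        ‖amplitude Arc (adapted α out) out‖ ^ 2) := by
  rw [mbqcRun, graphRun_brickwork _ _ _ (adapted_congr α)]
  simp

/-- The pad does not change the law of the recorded outcomes. -/
theorem blindRun_eq_mbqcRun (α : Qubit n w → ℝ) (p : Pad n w) : blindRun α p = mbqcRun α := by
  classical
  ext out
  rw [blindRun, graphRun_brickwork, mbqcRun_apply]
  · congr 3
    -- The rotation `θ` cancels between the revealed and the prepared angle.
    have h : (fun a => blindAngle α p out a - prepAngle p a) = fun a =>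
        (-1) ^ (Pad.r' p a).val * adapted α out a +
          (((Pad.r p a).val - ∑ b with (brickwork n w).Adj a b, ((Pad.r' p b).val : ℤ) : ℤ) : ℝ) *
            Real.pi := by
      funext a
      rw [blindAngle, prepAngle]
      push_cast
      have : ∀ s t : Finset (Qubit n w), s = t →
          ∑ b ∈ s, ((Pad.r' p b).val : ℝ) = ∑ b ∈ t, ((Pad.r' p b).val : ℝ) := by
        rintro s _ rfl; rfl
      rw [this _ (Finset.univ.filter fun b => (brickwork n w).Adj a b) (by congr!)]
      ring
    -- The multiple of `π` becomes a sign shift. Its part `r` cancels the relabelling of the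
    -- outcomes, and its sum of `r'` over neighbours is the shift that the reflection by `r'`
    -- requires.
    rw [h, amplitude_add_pi, ← norm_amplitude_reflect Arc arc_asymm (adapted α out) out (Pad.r' p)]
    congr 2
    funext a
    push_cast
    simp only [ZMod.natCast_zmod_val]
    rw [CharTwo.sub_eq_add, add_assoc, ← add_assoc (Pad.r p a), CharTwo.add_self_eq_zero, zero_add]
    congr!
  · intro s s' a h
    rw [blindAngle, blindAngle, adapted_congr α s s' a h]

/-- The bits `y` in the last column, and `0` elsewhere. -/
def onLastCol (y : Fin n → ZMod 2) (a : Qubit n w) : ZMod 2 := if a.2 = lastCol w then y a.1 else 0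

open Classical in
/-- The correction `sZ` undoes the effect of the corrections `sX` of the neighbours. -/
theorem add_sZ (s : Qubit n w → ZMod 2) (a : Qubit n w) :
    s a + sZ s a = onLastCol (lastOutcomes s) a +
      ∑ b with (brickwork n w).Adj a b, sX s b := by
  -- Exchanging the sums, each `d` is counted at most once because its right neighbour is unique.
  have h1 : ∑ b with (brickwork n w).Adj a b, sX s b =
      ∑ d, if ∃ c, IsNext d c ∧ (brickwork n w).Adj c a then s d else 0 := by
    simp only [sX, Finset.sum_filter]
    have : ∀ b, (if (brickwork n w).Adj a b then ∑ d, if IsNext d b then s d else 0 else 0) =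
        ∑ d, if IsNext d b ∧ (brickwork n w).Adj b a then s d else 0 := by
      intro b
      by_cases hb : (brickwork n w).Adj a b
      · simp [hb, hb.symm]
      · simp [hb, mt SimpleGraph.Adj.symm hb]
    simp only [this]
    rw [Finset.sum_comm]
    refine Finset.sum_congr rfl fun d _ => ?_
    by_cases hd : ∃ c, IsNext d c ∧ (brickwork n w).Adj c a
    · rw [if_pos hd]
      obtain ⟨c, hc⟩ := hd
      rw [Finset.sum_eq_single c, if_pos hc]
      · exact fun b _ hb => if_neg fun hb' => hb (isNext_left_unique hb'.1 hc.1)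
      · simp
    · rw [if_neg hd]
      exact Finset.sum_eq_zero fun b _ => if_neg fun hb => hd ⟨b, hb⟩
  have h2 : sZ s a = ∑ d ∈ Finset.univ.erase a,
      if ∃ c, IsNext d c ∧ (brickwork n w).Adj c a then s d else 0 := by
    rw [sZ, ← Finset.sum_filter]
    refine Finset.sum_congr ?_ fun _ _ => rfl
    ext d
    simp [and_comm]
  rw [h1, ← Finset.add_sum_erase _ _ (Finset.mem_univ a), ← h2, ← add_assoc]
  congr 1
  -- What remains is the term `d = a`, which `sZ` omits. It occurs in the full sum exactly when `a`
  -- has a right neighbour, that is outside the last column.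
  by_cases ha : a.2 = lastCol w
  · rw [onLastCol, if_pos ha, if_neg, add_zero, lastOutcomes, ← ha]
    rintro ⟨c, hc, _⟩
    have h := hc.2
    have h' := c.2.isLt
    rw [ha, lastCol, Fin.val_last] at h
    omega
  · rw [onLastCol, if_neg ha, if_pos, zero_add]
    have hlt : a.2.val + 1 < 4 * w + 1 := by
      have := a.2.isLt
      have h' : a.2.val ≠ 4 * w := fun e => ha (Fin.ext e)
      omega
    have hn : IsNext a (a.1, ⟨a.2.val + 1, hlt⟩) := ⟨rfl, rfl⟩
    refine ⟨_, hn, ?_⟩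
    rw [brickwork_eq, SimpleGraph.fromRel_adj]
    exact ⟨(arc_asymm _ _ (Or.inl hn)).1.symm, Or.inr (Or.inl hn)⟩

/-- The probability of a record depends on the outcomes in the last column only. -/
theorem norm_amplitude_adapted (α : Qubit n w → ℝ) (s : Qubit n w → ZMod 2) :
    ‖amplitude Arc (adapted α s) s‖ = ‖amplitude Arc α (onLastCol (lastOutcomes s))‖ := by
  classical
  -- Reflection by `sX s` supplies the signs `(-1)^{s_X}` of the adapted angles; `add_sZ` then
  -- matches the outcome signs.
  rw [← norm_amplitude_reflect Arc arc_asymm α _ (sX s)]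
  have h : adapted α s = fun a => (-1) ^ (sX s a).val * α a +
      (((sZ s a).val : ℤ) : ℝ) * Real.pi := by
    funext a
    rw [adapted, Int.cast_natCast]
  rw [h, amplitude_add_pi]
  congr 2
  funext a
  rw [Int.cast_natCast, ZMod.natCast_zmod_val, add_sZ]
  congr!

/-! ### The logical circuit -/

/-- With `x` and `y` read as the bits of two successive columns, the Hadamard sign `∑ i, y i * x i`
is the contribution of the horizontal edges between them. -/
theorem layer_apply (φ : Qubit n w → ℝ) (j : Fin (4 * w + 1)) (y x : Fin n → ZMod 2) :
    layer φ j y x = (∏ _i : Fin n, (1 / Real.sqrt 2 : ℂ)) * (∏ i, phase (-φ (i, j)) (x i)) *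
      sign (∑ i, y i * x i) *
        sign (edgeForm (fun i i' => IsRung (w := w) (i, j) (i', j)) x) := by
  rw [layer, comap_brickwork, entangle_fromRel _ (rung_asymm j), Matrix.mul_diagonal, tensorOp,
    Matrix.of_apply, sign_sum, ← Finset.prod_mul_distrib, ← Finset.prod_mul_distrib]
  congr 1
  refine Finset.prod_congr rfl fun i _ => ?_
  rw [RZ, Matrix.diagonal_conjTranspose, Matrix.mul_diagonal, hadamard_apply, Pi.star_apply,
    ← star_phase, phase]
  ring

/-- Grouping the edges by column matches them with the factors of the path sum: horizontal edges
with Hadamard gates, vertical ones with controlled-`Z` gates. -/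
theorem edgeForm_arc (x : Qubit n w → ZMod 2) :
    edgeForm Arc x = (∑ j : Fin (4 * w), ∑ i, x (i, j.succ) * x (i, j.castSucc)) +
      ∑ j, edgeForm (fun i i' => IsRung (w := w) (i, j) (i', j)) fun i => x (i, j) := by
  classical
  have h1 : edgeForm Arc x = edgeForm IsNext x + edgeForm IsRung x := by
    simp only [edgeForm, ← Finset.sum_add_distrib]
    refine Finset.sum_congr rfl fun a _ => Finset.sum_congr rfl fun b _ => ?_
    by_cases hn : IsNext a b
    · have hr : ¬IsRung a b := fun hr => by
        have := hn.2
        rw [hr.1] at this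
        omega
      simp [Arc, hn, hr]
    · simp [Arc, hn]
  rw [h1]
  congr 1
  · simp only [edgeForm]
    rw [Fintype.sum_prod_type_right, Fin.sum_univ_castSucc]
    have hl : ∑ i, ∑ b : Qubit n w, (if IsNext (i, Fin.last (4 * w)) b then
        x (i, Fin.last (4 * w)) * x b else 0) = 0 := by
      refine Finset.sum_eq_zero fun i _ => Finset.sum_eq_zero fun b _ => if_neg fun h => ?_
      have h' := h.2
      have := b.2.isLt
      rw [Fin.val_last] at h'
      omega
    rw [hl, add_zero]
    refine Finset.sum_congr rfl fun j _ => Finset.sum_congr rfl fun i _ => ?_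
    have hn : IsNext (i, j.castSucc) (i, j.succ) := ⟨rfl, rfl⟩
    rw [Finset.sum_eq_single (i, j.succ), if_pos hn, mul_comm]
    · exact fun b _ hb => if_neg fun h => hb (isNext_left_unique h hn)
    · simp
  · simp only [edgeForm]
    rw [Fintype.sum_prod_type_right]
    refine Finset.sum_congr rfl fun j _ => Finset.sum_congr rfl fun i _ => ?_
    rw [Fintype.sum_prod_type_right, Finset.sum_eq_single j]
    · intro j' _ hj
      exact Finset.sum_eq_zero fun i' _ => if_neg fun h => hj h.1.symm
    · simp

/-- A path of the circuit is a bit string on all physical qubits. The last layer of Hadamard gates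
has no edges to match, and yields the signs `onLastCol y` instead. -/
theorem logicalState_eq (φ : Qubit n w → ℝ) (y : Fin n → ZMod 2) :
    logicalState φ y = ((∏ _i : Fin n, (1 / Real.sqrt 2 : ℂ)) *
      ∏ _j : Fin (4 * w + 1), ∏ _i : Fin n, (1 / Real.sqrt 2 : ℂ)) *
        amplitude Arc φ (onLastCol y) := by
  rw [logicalState, foldl_mulVec_eq_sum, amplitude,
    ← ((Equiv.prodComm _ _).arrowCongr (Equiv.refl _) |>.trans (Equiv.curry _ _ _)).symm.sum_comp,
    Finset.mul_sum]
  refine Finset.sum_congr rfl fun x _ => ?_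
  have hx : ((Equiv.prodComm (Fin n) (Fin (4 * w + 1))).arrowCongr (Equiv.refl (ZMod 2)) |>.trans
      (Equiv.curry _ _ _)).symm x = fun a => x a.2 a.1 := rfl
  rw [hx, edgeForm_arc]
  have h0 : productState (fun _ => ketX 0) (x 0) = ∏ _i : Fin n, (1 / Real.sqrt 2 : ℂ) := by
    refine Finset.prod_congr rfl fun i _ => ?_
    change ketX 0 (x 0 i) = _
    rw [ketX_apply, zero_mul, sign_zero]
  have hc : ∏ a : Qubit n w, sign (onLastCol y a * x a.2 a.1) =
      sign (∑ i, y i * x (Fin.last _) i) := by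
    rw [sign_sum, Fintype.prod_prod_type_right, Fin.prod_univ_castSucc]
    simp [onLastCol, sign_zero, (Fin.castSucc_lt_last _).ne]
  have hp : ∏ a : Qubit n w, phase (-φ a) (x a.2 a.1) = ∏ j, ∏ i, phase (-φ (i, j)) (x j i) :=
    Fintype.prod_prod_type_right _
  rw [Finset.prod_mul_distrib, hc, hp, h0, sign_add,
    sign_sum _ fun j : Fin (4 * w) => ∑ i, x j.succ i * x j.castSucc i,
    sign_sum _ fun j => edgeForm (fun i i' => IsRung (w := w) (i, j) (i', j)) fun i => x j i]
  simp only [layer_apply, Finset.prod_mul_distrib, Fin.prod_univ_castSucc (n := 4 * w)]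
  ring

/-- The measurement-based computation implements the logical circuit. -/
theorem mbqcRun_map_lastOutcomes (α : Qubit n w → ℝ) :
    (mbqcRun α).map lastOutcomes = logicalLaw α := by
  classical
  obtain ⟨K, hK, hKy⟩ : ∃ K : ℂ, K ≠ 0 ∧
      ∀ y : Fin n → ZMod 2, logicalState α y = K * amplitude Arc α (onLastCol y) :=
    ⟨_, by simp, logicalState_eq α⟩
  obtain ⟨D, hD⟩ : ∃ D : ENNReal, ∀ out, mbqcRun α out = D * logicalLaw α (lastOutcomes out) := by
    refine ⟨ENNReal.ofReal (‖∏ _a : Qubit n w, (1 / 2 : ℂ)‖ ^ 2 / ‖K‖ ^ 2), fun out => ?_⟩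
    rw [mbqcRun_apply, norm_amplitude_adapted, logicalLaw, PMF.ofFintype_apply, hKy,
      ← ENNReal.ofReal_mul (by positivity), norm_mul]
    congr 1
    have : ‖K‖ ≠ 0 := norm_ne_zero_iff.mpr hK
    field_simp
  refine PMF_eq_of_proportional _ _
    (∑ out : Qubit n w → ZMod 2, if 0 = lastOutcomes out then D else 0) fun y => ?_
  -- Translation by `onLastCol y` carries the records with zero last column onto those with last
  -- column `y`, so all fibres have the same size and the factor does not depend on `y`.
  rw [PMF.map_apply, tsum_fintype, Finset.sum_mul, ← Equiv.sum_comp (Equiv.addRight (onLastCol y))]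
  refine Finset.sum_congr rfl fun out _ => ?_
  have h : lastOutcomes (out + onLastCol y) = lastOutcomes out + y := by
    funext i
    simp [lastOutcomes, onLastCol]
  rw [Equiv.coe_addRight, hD, h]
  by_cases h0 : lastOutcomes out = 0
  · simp [h0]
  · simp [h0, Ne.symm h0]

/-! ### The protocol -/

/-- Once the runs no longer depend on the pads, averaging over the pads is trivial. The verdict and
the output see each run only through `lastOutcomes`, so the independent product may be pushed
forward factor by factor. -/
theorem protocol_eq_idealProtocol (v : ℕ) (φ : Qubit n w → ℝ)
    (traps : PMF (Fin (v + 1) → Qubit n w → ℝ)) :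
    protocol v φ traps = idealProtocol v φ traps := by
  simp only [protocol, idealProtocol, blindRun_eq_mbqcRun, PMF.bind_const,
    ← mbqcRun_map_lastOutcomes, ← independent_map, PMF.bind_map]
  rfl

/-- For every `vt` and every draw of traps the marginal at `vt` is the target law, so both averages
are over a constant. -/
theorem idealProtocol_map_snd (v : ℕ) (φ : Qubit n w → ℝ)
    (traps : PMF (Fin (v + 1) → Qubit n w → ℝ)) :
    (idealProtocol v φ traps).map Prod.snd = logicalLaw φ := by
  simp only [idealProtocol, PMF.map_bind, PMF.pure_map]
  have h : ∀ (vt : Fin (v + 1)) (τ : Fin (v + 1) → Qubit n w → ℝ),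
      ((independent fun k => logicalLaw (Function.update τ vt φ k)).bind fun s =>
        PMF.pure (s vt)) = logicalLaw φ := by
    intro vt τ
    have := independent_map_apply (fun k => logicalLaw (Function.update τ vt φ k)) vt
    rwa [Function.update_self] at this
  simp only [h, PMF.bind_const]

theorem traceDistance_self {α : Type} [Fintype α] [DecidableEq α] (ρ : Matrix α α ℂ) :
    traceDistance ρ ρ = 0 := by
  simp [traceDistance]

end Brickwork

end BlindMBQC
end

theorem theorem1 (n w v : ℕ) (φ : BlindMBQC.Qubit n w → ℝ)
    (traps : PMF (Fin (v + 1) → BlindMBQC.Qubit n w → ℝ)) :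
    (∀ (α : BlindMBQC.Qubit n w → ℝ) (p : BlindMBQC.Pad n w),
      BlindMBQC.blindRun α p = BlindMBQC.mbqcRun α) ∧
    (∀ α : BlindMBQC.Qubit n w → ℝ,
      (BlindMBQC.mbqcRun α).map BlindMBQC.lastOutcomes = BlindMBQC.logicalLaw α) ∧
    BlindMBQC.protocol v φ traps = BlindMBQC.idealProtocol v φ traps ∧
    (BlindMBQC.protocol v φ traps).map Prod.snd = BlindMBQC.logicalLaw φ ∧
    BlindMBQC.traceDistance
      (BlindMBQC.classicalState (BlindMBQC.logicalLaw φ))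
      (BlindMBQC.classicalState ((BlindMBQC.protocol v φ traps).map Prod.snd)) = 0 := by
  have h := BlindMBQC.protocol_eq_idealProtocol v φ traps
  have h' : (BlindMBQC.protocol v φ traps).map Prod.snd = BlindMBQC.logicalLaw φ := by
    rw [h, BlindMBQC.idealProtocol_map_snd]
  exact ⟨BlindMBQC.blindRun_eq_mbqcRun, BlindMBQC.mbqcRun_map_lastOutcomes, h, h', by
    rw [h', BlindMBQC.traceDistance_self]⟩
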